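/- Let $\mathbb{N}=\{0,1,2,\dots\}$. A numerical semigroup is a subset $H\subseteq\mathbb{N}$ that contains $0$, is closed under addition, and satisfies $\gcd(H)=1$. For a field $k$, let $k[\![H]\!]$ be the subring of $k[\![t]\!]$ consisting of the power series $\sum_{h\in H}c_h t^h$ with $c_h\in k$; it is a one-dimensional Cohen–Macaulay complete local domain with a canonical module. A finitely generated module $C$ over a commutative ring $R$ is called semidualizing if the homothety map $R\to\operatorname{Hom}_R(C,C)$, $r\mapsto(c\mapsto rc)$, is an isomorphism and $\operatorname{Ext}^i_R(C,C)=0$ for all $i>0$. If $R$ is a Cohen–Macaulay local ring with a canonical module $K$, a semidualizing $R$-module $C$ is called nontrivial if $C\not\cong R$ and $C\not\cong K$. **Corollary 5.4.** Let $k$ be a field, let $H$ be a numerical semigroup, let $a\in H$ and $b\in\mathbb{N}$ with $\gcd(a,b)=1$, and let $H'=\langle a,\,bH\rangle$ be the semigroup generated by $a$ and all $bh$ with $h\in H$. If $k[\![H]\!]$ has a nontrivial semidualizing module, then so does $k[\![H']\!]$. -/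

import Mathlib

open CategoryTheory

universe u

section Modules

variable (R : Type u) [CommRing R]

/-- A finitely generated `R`-module `C` is *semidualizing* if the homothety map
`R → Hom_R(C, C)`, `r ↦ (c ↦ r • c)`, is an isomorphism and `Ext^i_R(C, C) = 0` for all `i > 0`. -/
structure IsSemidualizing (C : Type u) [AddCommGroup C] [Module R C] : Prop where
  finite : Module.Finite R C
  homothety_bijective : Function.Bijective (LinearMap.lsmul R C)
  ext_eq_zero : ∀ i : ℕ, 0 < i →
    Subsingleton (Abelian.Ext (ModuleCat.of R C) (ModuleCat.of R C) i)

/-- `K` is a *canonical module* of the Cohen-Macaulay local ring `R` with residue field `κ` and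
Krull dimension `d`: it is finitely generated, `Ext^d_R(κ, K) ≅ κ`, and `Ext^i_R(κ, K) = 0` for all
`i ≠ d`. (Over such a ring this says that `K` is maximal Cohen-Macaulay of type one and of finite
injective dimension.) -/
structure IsCanonicalModule [IsLocalRing R] (K : Type u) [AddCommGroup K] [Module R K] :
    Prop where
  finite : Module.Finite R K
  ext_dim : ∀ d : ℕ, (d : WithBot ℕ∞) = ringKrullDim R →
    Nonempty (Abelian.Ext (ModuleCat.of R (IsLocalRing.ResidueField R)) (ModuleCat.of R K) d
      ≃ₗ[R] IsLocalRing.ResidueField R)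
  ext_eq_zero : ∀ i : ℕ, (i : WithBot ℕ∞) ≠ ringKrullDim R →
    Subsingleton
      (Abelian.Ext (ModuleCat.of R (IsLocalRing.ResidueField R)) (ModuleCat.of R K) i)

/-- `R` has a *nontrivial semidualizing module*: a semidualizing module which is isomorphic neither
to `R` nor to the canonical module of `R`. -/
def HasNontrivialSemidualizingModule [IsLocalRing R] : Prop :=
  ∃ (C : Type u) (_ : AddCommGroup C) (_ : Module R C),
    IsSemidualizing R C ∧ ¬ Nonempty (C ≃ₗ[R] R) ∧
      ∀ (K : Type u) [AddCommGroup K] [Module R K], IsCanonicalModule R K →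
        ¬ Nonempty (C ≃ₗ[R] K)

end Modules

/-- A *numerical semigroup*: a submonoid of `(ℕ, +)` whose elements have greatest common
divisor `1`. -/
def IsNumericalSemigroup (H : AddSubmonoid ℕ) : Prop :=
  Nat.setGcd (H : Set ℕ) = 1

/-- The semigroup `⟨a, bH⟩` generated by `a` and all `b * h` with `h ∈ H`. -/
def gluedSemigroup (H : AddSubmonoid ℕ) (a b : ℕ) : AddSubmonoid ℕ :=
  AddSubmonoid.closure (insert a ((fun h => b * h) '' (H : Set ℕ)))

/-- The semigroup ring `k⟦H⟧`, as a subring of `k⟦t⟧`: the power series all of whose exponents lie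
in `H`. For `H = ⟨a₁, …, aₗ⟩` this is `k⟦t ^ a₁, …, t ^ aₗ⟧`. -/
def semigroupRing (k : Type u) [Field k] (H : AddSubmonoid ℕ) : Subalgebra k (PowerSeries k) where
  carrier := {f | ∀ n, PowerSeries.coeff n f ≠ 0 → n ∈ H}
  mul_mem' := by
    intro f g hf hg n hn
    rw [PowerSeries.coeff_mul] at hn
    obtain ⟨p, hp, hne⟩ := Finset.exists_ne_zero_of_sum_ne_zero hn
    rw [← Finset.HasAntidiagonal.mem_antidiagonal.1 hp]
    exact H.add_mem (hf _ (left_ne_zero_of_mul hne)) (hg _ (right_ne_zero_of_mul hne))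
  add_mem' := by
    intro f g hf hg n hn
    by_cases h : PowerSeries.coeff n f = 0
    · exact hg n (by simpa [h] using hn)
    · exact hf n h
  algebraMap_mem' := by
    intro r n hn
    rw [PowerSeries.algebraMap_apply, PowerSeries.coeff_C] at hn
    by_cases h : n = 0
    · exact h ▸ H.zero_mem
    · simp [h] at hn

theorem semigroupRing_inv_mem {k : Type u} [Field k] {H : AddSubmonoid ℕ} {f : PowerSeries k}
    (hf : f ∈ semigroupRing k H) : f⁻¹ ∈ semigroupRing k H := by
  intro n
  induction n using Nat.strong_induction_on with
  | _ n ih =>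
    intro hn
    rw [PowerSeries.coeff_inv] at hn
    by_cases h0 : n = 0
    · exact h0 ▸ H.zero_mem
    · rw [if_neg h0] at hn
      obtain ⟨p, hp, hne⟩ := Finset.exists_ne_zero_of_sum_ne_zero (right_ne_zero_of_mul hn)
      rw [← Finset.HasAntidiagonal.mem_antidiagonal.1 hp]
      by_cases hlt : p.2 < n
      · rw [if_pos hlt] at hne
        exact H.add_mem (hf _ (left_ne_zero_of_mul hne)) (ih _ hlt (right_ne_zero_of_mul hne))
      · simp [hlt] at hne

theorem semigroupRing_isUnit {k : Type u} [Field k] {H : AddSubmonoid ℕ} (f : semigroupRing k H)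
    (h : PowerSeries.constantCoeff (f : PowerSeries k) ≠ 0) : IsUnit f :=
  IsUnit.of_mul_eq_one ⟨_, semigroupRing_inv_mem f.2⟩
    (Subtype.ext (PowerSeries.mul_inv_cancel _ h))

instance semigroupRing_isLocalRing (k : Type u) [Field k] (H : AddSubmonoid ℕ) :
    IsLocalRing (semigroupRing k H) :=
  IsLocalRing.of_isUnit_or_isUnit_one_sub_self fun f => by
    by_cases h : PowerSeries.constantCoeff (f : PowerSeries k) = 0
    · exact Or.inr (semigroupRing_isUnit _ (by simp [h]))
    · exact Or.inl (semigroupRing_isUnit _ h)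

/-!
Put `R = k⟦H⟧` and `S = k⟦⟨a, bH⟩⟧`. If `b = 0` then `a = 1 ∈ H` and both semigroups are `ℕ`.
Otherwise `f(t) ↦ f(t ^ b)` makes `S` an `R`-algebra, and since `a ∈ H` is prime to `b`, the powers
`t ^ (a * i)` with `i < b` are a basis of `S` over `R` (`nonempty_gluing_linearEquiv`). The result
then holds for every local algebra `S` that is free of finite rank `n` over a local ring `R`
(`HasNontrivialSemidualizingModule.of_free_of_finite`): if `C` is a nontrivial semidualizing
`R`-module, `S ⊗ C` is one over `S`. Note that `S ⊗ C ≅ C ^ n` over `R`.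

* Flat base change `Ext_S(S ⊗ M, N) ≅ Ext_R(M, N)` (`exists_ext_baseChange_equiv`, an instance of
  the adjunction for `Ext` along an exact left adjoint, `CategoryTheory.Adjunction.extAddHom`)
  reduces the vanishing of `Ext_S(S ⊗ C, S ⊗ C)` to that of `Ext_R(C, C)`. The homothety map of
  `S ⊗ C` is computed in coordinates.
* If `S ⊗ C ≅ S`, then `C ^ n ≅ R ^ n`, so `C` is projective, hence free, of rank one.
* If `S ⊗ C` is canonical, so is `C` (`IsCanonicalModule.of_baseChange_equiv`), which contradicts
  the choice of `C`. Indeed, let `d` be the common dimension of `R` and `S` and `κ` the residue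
  field of `R`. By dévissage, `Ext_S^d(-, S ⊗ C)` preserves the length of modules of finite length
  and the other `Ext_S^i(-, S ⊗ C)` vanish on them. Applied to `S ⊗ κ`, whose length over `R` is
  `n`, this gives that `Ext_S^d(S ⊗ κ, S ⊗ C) ≅ Ext_R^d(κ, C) ^ n` has length `n` over `R`, so
  `Ext_R^d(κ, C)` has length one, while the other `Ext_R^i(κ, C)` are zero.
-/

/-! ### `Ext` and adjunctions -/

section ExtAdjunction

open Limits Abelian

universe w w' v v' u₁ u₂

variable {C : Type u₁} [Category.{v} C] [Abelian C] {D : Type u₂} [Category.{v'} D] [Abelian D]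
  [HasExt.{w} C] [HasExt.{w'} D] {F : C ⥤ D} {G : D ⥤ C} (adj : F ⊣ G)
  [F.Additive] [PreservesFiniteLimits F] [PreservesFiniteColimits F]

/-- For an adjunction `F ⊣ G` with `F` exact, the map `Ext^n(X, G Y) → Ext^n(F X, Y)` that applies
`F` and composes with the counit. -/
noncomputable def CategoryTheory.Adjunction.extAddHom (X : C) (Y : D) (n : ℕ) :
    Ext.{w} X (G.obj Y) n →+ Ext.{w'} (F.obj X) Y n :=
  ((Ext.mk₀ (adj.counit.app Y)).postcomp (F.obj X) (add_zero n)).comp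
    (F.mapExtAddHom X (G.obj Y) n)

theorem CategoryTheory.Adjunction.extAddHom_apply (X : C) (Y : D) (n : ℕ)
    (e : Ext.{w} X (G.obj Y) n) :
    adj.extAddHom X Y n e =
      (e.mapExactFunctor F).comp (Ext.mk₀ (adj.counit.app Y)) (add_zero n) := rfl

attribute [local simp] Ext.mapExactFunctor_comp Ext.mapExactFunctor_mk₀
  Ext.mapExactFunctor_extClass CategoryTheory.Adjunction.extAddHom_apply

attribute [local instance] Ext.subsingleton_of_projective in
/-- Dimension shifting in the first variable reduces the claim to the bijection of the adjunction
on morphisms. -/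
theorem CategoryTheory.Adjunction.extAddHom_bijective [EnoughProjectives C]
    [G.PreservesEpimorphisms] (X : C) (Y : D) (n : ℕ) :
    Function.Bijective (adj.extAddHom X Y n) := by
  induction n generalizing X with
  | zero =>
    have h : ⇑(adj.extAddHom X Y 0) =
        Ext.homEquiv₀.symm ∘ (adj.homEquiv X Y).symm ∘ Ext.homEquiv₀ := by
      ext x
      obtain ⟨y, rfl⟩ := (Ext.mk₀_bijective X (G.obj Y)).2 x
      simp [Ext.homEquiv₀, Adjunction.homEquiv_counit]
    rw [h]
    exact (Ext.homEquiv₀.symm.bijective.comp (adj.homEquiv X Y).symm.bijective).comp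
      Ext.homEquiv₀.bijective
  | succ n hn =>
    let P : ProjectivePresentation X := Classical.arbitrary _
    let S := ShortComplex.mk _ _ (kernel.condition P.f)
    have : Projective (S.map F).X₂ := adj.map_projective _ P.projective
    have hS : S.ShortExact := { exact := ShortComplex.exact_kernel P.f }
    exact AddMonoidHom.bijective_of_surjective_of_bijective_of_right_exact _ _ _ _
      (adj.extAddHom S.X₂ Y n) (adj.extAddHom S.X₁ Y n) (adj.extAddHom S.X₃ Y (n + 1))
      (AddMonoidHom.ext fun x ↦ by
        change (Ext.mk₀ (F.map S.f)).comp (adj.extAddHom S.X₂ Y n x) (zero_add n) =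
          adj.extAddHom S.X₁ Y n ((Ext.mk₀ S.f).comp x (zero_add n))
        simp)
      (AddMonoidHom.ext fun x ↦ by
        change (hS.map_of_exact F).extClass.comp (adj.extAddHom S.X₁ Y n x) (add_comm 1 n) =
          adj.extAddHom S.X₃ Y (n + 1) (hS.extClass.comp x (add_comm 1 n))
        rw [adj.extAddHom_apply, adj.extAddHom_apply, Ext.mapExactFunctor_comp,
          Ext.mapExactFunctor_extClass]
        exact (Ext.comp_assoc_of_third_deg_zero _ _ _ _).symm)
      ((ShortComplex.ab_exact_iff_function_exact _).1
        (Ext.contravariant_sequence_exact₁' hS (G.obj Y) n (n + 1) (add_comm 1 n)))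
      ((ShortComplex.ab_exact_iff_function_exact _).1
        (Ext.contravariant_sequence_exact₁' (hS.map_of_exact F) Y n (n + 1) (add_comm 1 n)))
      (hn _).surjective (hn _)
      (fun x₃ ↦ Ext.contravariant_sequence_exact₃ hS _ x₃ (by subsingleton) (add_comm 1 n))
      (fun y₃ ↦ Ext.contravariant_sequence_exact₃ (hS.map_of_exact F) _ y₃ (by subsingleton)
        (add_comm 1 n))

end ExtAdjunction

/-! ### `Ext` of modules under base change -/

section ExtModules

open Abelian

/-- `Ext` is invariant under isomorphism in both variables. -/
noncomputable def extCongr {R : Type u} [CommRing R] {X X' Y Y' : ModuleCat.{u} R}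
    (e : X ≅ X') (f : Y ≅ Y') (n : ℕ) : Ext X Y n ≃ₗ[R] Ext X' Y' n :=
  LinearEquiv.ofLinearMap
    (Ext.precompOfLinear (Ext.mk₀ e.inv) R Y' (zero_add n) ∘ₗ
      Ext.postcompOfLinear (Ext.mk₀ f.hom) R X (add_zero n))
    (Ext.precompOfLinear (Ext.mk₀ e.hom) R Y (zero_add n) ∘ₗ
      Ext.postcompOfLinear (Ext.mk₀ f.inv) R X' (add_zero n))
    (by ext x; simp) (by ext x; simp)

/-- `Ext` commutes with finite direct sums in the second variable. -/
noncomputable def extPi {R : Type u} [CommRing R] (X : ModuleCat.{u} R) {ι : Type} [Fintype ι]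
    [DecidableEq ι] (M : Type u) [AddCommGroup M] [Module R M] (n : ℕ) :
    Ext X (ModuleCat.of R (ι → M)) n ≃ₗ[R] (ι → Ext X (ModuleCat.of R M) n) :=
  LinearEquiv.ofLinearMap
    (LinearMap.pi fun i =>
      Ext.postcompOfLinear (Ext.mk₀ (ModuleCat.ofHom (LinearMap.proj i))) R X (add_zero n))
    (∑ i, Ext.postcompOfLinear (Ext.mk₀ (ModuleCat.ofHom (LinearMap.single R (fun _ => M) i)))
      R X (add_zero n) ∘ₗ LinearMap.proj i)
    (LinearMap.ext fun x ↦ funext fun j ↦ by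
      have h (k : ι) : ModuleCat.ofHom (LinearMap.single R (fun _ : ι => M) k) ≫
          ModuleCat.ofHom (LinearMap.proj j) = if k = j then 𝟙 _ else 0 := by
        ext m
        split_ifs with h
        · simp [h]
        · simp [Ne.symm h]
      simp only [LinearMap.comp_apply, LinearMap.sum_apply, LinearMap.pi_apply,
        LinearMap.proj_apply, LinearMap.flip_apply, Ext.bilinearCompOfLinear_apply_apply,
        Ext.sum_comp, Ext.comp_assoc_of_third_deg_zero, Ext.mk₀_comp_mk₀, h, LinearMap.id_apply]
      rw [Finset.sum_eq_single j (fun k _ hk ↦ by simp [hk]) (by simp)]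
      simp)
    (LinearMap.ext fun x ↦ by
      have h : ∑ i, (ModuleCat.ofHom (LinearMap.proj i) ≫
          ModuleCat.ofHom (LinearMap.single R (fun _ : ι => M) i)) = 𝟙 _ := by
        ext m j
        simp [ModuleCat.hom_sum, Finset.sum_apply, Pi.single_apply]
      simp [← Ext.comp_sum, ← Ext.mk₀_sum, h])

variable (R S : Type u) [CommRing R] [CommRing S] [Algebra R S]

/-- The extension of scalars functor on objects is the base change `S ⊗[R] M`. -/
noncomputable def extendScalarsIso (M : Type u) [AddCommGroup M] [Module R M] :
    (ModuleCat.extendScalars (algebraMap R S)).obj (ModuleCat.of R M) ≅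
      ModuleCat.of S (TensorProduct R S M) :=
  letI e : (ModuleCat.restrictScalars (algebraMap R S)).obj (ModuleCat.of S S) ≃ₗ[R] S :=
    { AddEquiv.refl S with map_smul' := fun r s ↦ (Algebra.smul_def (A := S) r s).symm }
  letI g : (ModuleCat.extendScalars (algebraMap R S)).obj (ModuleCat.of R M) ≃+
      TensorProduct R S M :=
    (TensorProduct.congr e (LinearEquiv.refl R M)).toAddEquiv
  letI g' : (ModuleCat.extendScalars (algebraMap R S)).obj (ModuleCat.of R M) ≃ₗ[S]
      TensorProduct R S M :=
    g.toLinearEquiv fun s x ↦ by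
      have h0 : g (s • 0) = s • g 0 := by simp
      have hadd (x y) (hx : g (s • x) = s • g x) (hy : g (s • y) = s • g y) :
          g (s • (x + y)) = s • g (x + y) := by simp [hx, hy]
      induction x using TensorProduct.induction_on with
      | zero => exact h0
      | tmul t m => rfl
      | add x y hx hy => exact hadd x y hx hy
  g'.toModuleIso

/-- Flat base change for `Ext`; the last clause says that the isomorphism is `R`-linear. -/
theorem exists_ext_baseChange_equiv [Module.Flat R S] (M N : Type u) [AddCommGroup M] [Module R M]
    [AddCommGroup N] [Module R N] [Module S N] [IsScalarTower R S N] (n : ℕ) :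
    ∃ e : Ext (ModuleCat.of R M) (ModuleCat.of R N) n ≃+
      Ext (ModuleCat.of S (TensorProduct R S M)) (ModuleCat.of S N) n,
      ∀ (r : R) x, e (r • x) = algebraMap R S r • e x := by
  let f := algebraMap R S
  let adj := ModuleCat.extendRestrictScalarsAdj.{u} f
  have : Limits.PreservesFiniteLimits (ModuleCat.extendScalars.{u, u, u} f) :=
    ModuleCat.preservesFiniteLimits_extendScalars_of_flat
      ((RingHom.flat_algebraMap_iff).2 inferInstance)
  have : (ModuleCat.extendScalars.{u, u, u} f).Additive := adj.left_adjoint_additive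
  have : Limits.PreservesFiniteColimits (ModuleCat.extendScalars.{u, u, u} f) := inferInstance
  let i : ModuleCat.of R N ≅ (ModuleCat.restrictScalars f).obj (ModuleCat.of S N) :=
    letI i' : N ≃+ (ModuleCat.restrictScalars f).obj (ModuleCat.of S N) := AddEquiv.refl N
    letI i'' : N ≃ₗ[R] (ModuleCat.restrictScalars f).obj (ModuleCat.of S N) :=
      i'.toLinearEquiv fun r x ↦ (algebraMap_smul S r (x : N)).symm
    i''.toModuleIso
  let e := AddEquiv.ofBijective _
    (adj.extAddHom_bijective (ModuleCat.of R M) (ModuleCat.of S N) n)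
  refine ⟨(extCongr (Iso.refl _) i n).toAddEquiv.trans
    (e.trans (extCongr (extendScalarsIso R S M) (Iso.refl _) n).toAddEquiv), fun r x ↦ ?_⟩
  have he (y) : e (r • y) = f r • e y := by
    change adj.extAddHom _ _ n (r • y) = f r • adj.extAddHom _ _ n y
    have h : r • 𝟙 ((ModuleCat.restrictScalars f).obj (ModuleCat.of S N)) =
        (ModuleCat.restrictScalars f).map (f r • 𝟙 (ModuleCat.of S N)) := rfl
    have hc : (ModuleCat.extendScalars f).map
          ((ModuleCat.restrictScalars f).map (f r • 𝟙 (ModuleCat.of S N))) ≫ adj.counit.app _ =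
        adj.counit.app _ ≫ (f r • 𝟙 (ModuleCat.of S N)) := adj.counit.naturality _
    rw [Ext.smul_eq_comp_mk₀ y, Ext.smul_eq_comp_mk₀ (adj.extAddHom _ _ n y), h,
      Adjunction.extAddHom_apply, Adjunction.extAddHom_apply, Ext.mapExactFunctor_comp,
      Ext.mapExactFunctor_mk₀, Ext.comp_assoc_of_third_deg_zero, Ext.comp_assoc_of_third_deg_zero,
      Ext.mk₀_comp_mk₀, Ext.mk₀_comp_mk₀, hc]
  change (extCongr _ _ n) (e (extCongr _ _ n (r • x))) =
    f r • (extCongr _ _ n) (e (extCongr _ _ n x))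
  rw [map_smul, he, map_smul]

end ExtModules

/-! ### Commutative algebra of finite free extensions -/

section Algebra

theorem ringKrullDim_eq_of_isIntegral {R S : Type*} [CommRing R] [CommRing S] [Algebra R S]
    [Algebra.IsIntegral R S] [FaithfulSMul R S] : ringKrullDim S = ringKrullDim R := by
  apply le_antisymm
  · exact Order.krullDim_le_of_strictMono (PrimeSpectrum.comap (algebraMap R S))
      fun P Q h ↦ Ideal.IsIntegral.comap_lt_comap h
  · refine iSup_le fun l ↦ ?_
    obtain ⟨P, -, hP, hPl⟩ := Ideal.exists_ideal_over_prime_of_isIntegral (S := S) l.head.asIdeal ⊥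
      (by simp [← RingHom.ker_eq_comap_bot])
    have : P.LiesOver l.head.asIdeal := ⟨hPl.symm⟩
    obtain ⟨L, hL, -⟩ := Ideal.exists_ltSeries_of_hasGoingUp (S := S) l P
    exact hL ▸ le_iSup (fun p : LTSeries (PrimeSpectrum S) ↦ (p.length : WithBot ℕ∞)) L

/-- Over a local ring all composition factors are isomorphic to the residue field. -/
theorem IsFiniteLength.length_restrictScalars (R : Type*) {S : Type*} [CommRing R] [CommRing S]
    [IsLocalRing S] [Algebra R S] {M : Type*} [AddCommGroup M] [Module S M]
    (hM : IsFiniteLength S M) : ∀ [Module R M] [IsScalarTower R S M],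
    Module.length R M = Module.length S M * Module.length R (IsLocalRing.ResidueField S) := by
  induction hM with
  | of_subsingleton => intros; simp [Module.length_eq_zero]
  | @of_simple_quotient M _ _ N _ _ ih =>
    intro _ _
    obtain ⟨I, hI, ⟨e⟩⟩ := isSimpleModule_iff_quot_maximal.1 ‹IsSimpleModule S (M ⧸ N)›
    obtain rfl := IsLocalRing.eq_maximalIdeal hI
    have h : Module.length R (M ⧸ N) = Module.length R (IsLocalRing.ResidueField S) :=
      (e.restrictScalars R).length_eq
    rw [Module.length_eq_add_of_exact (R := S) N.subtype N.mkQ N.injective_subtype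
        N.mkQ_surjective (LinearMap.exact_subtype_mkQ N),
      Module.length_eq_add_of_exact (R := R) (N.subtype.restrictScalars R)
        (N.mkQ.restrictScalars R) N.injective_subtype N.mkQ_surjective
        (LinearMap.exact_subtype_mkQ N), ih, h, Module.length_eq_one S (M ⧸ N), add_mul, one_mul]

/-- Such a `C` is projective, hence free over the local ring `R`, and its rank is one. -/
theorem nonempty_linearEquiv_of_pi {R : Type u} [CommRing R] [IsLocalRing R] {C : Type u}
    [AddCommGroup C] [Module R C] [Module.Finite R C] {ι : Type*} [Fintype ι] [Nonempty ι]
    (e : (ι → C) ≃ₗ[R] (ι → R)) : Nonempty (C ≃ₗ[R] R) := by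
  classical
  have i := Classical.arbitrary ι
  have : Module.Projective R (ι → C) := .of_equiv e.symm
  have : Module.Projective R C := .of_split (LinearMap.single R (fun _ : ι ↦ C) i)
    (LinearMap.proj i) (by ext; simp)
  have : Module.Free R C := Module.free_of_flat_of_isLocalRing
  have h := e.finrank_eq
  rw [Module.finrank_pi_fintype, Module.finrank_pi] at h
  refine ⟨LinearEquiv.ofFinrankEq _ _ ?_⟩
  have : 0 < Fintype.card ι := Fintype.card_pos
  simp at h
  simp; tauto

/-- In coordinates with respect to a basis of `S`, an `S`-linear endomorphism of `S ⊗ C` restricts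
on `1 ⊗ C` to a family of `R`-linear endomorphisms of `C`, that is, of elements of `R`. -/
theorem lsmul_baseChange_bijective {R S : Type*} [CommRing R] [CommRing S] [Algebra R S]
    [Module.Free R S] [Module.Finite R S] {C : Type*} [AddCommGroup C] [Module R C]
    (hC : Function.Bijective (LinearMap.lsmul R C)) :
    Function.Bijective (LinearMap.lsmul S (TensorProduct R S C)) := by
  let b := Module.Free.chooseBasis R S
  have hrepr (s : S) (c : C) (i) :
      TensorProduct.equivFinsuppOfBasisLeft b (s ⊗ₜ[R] c) i = b.repr s i • c := by simp
  constructor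
  · refine (injective_iff_map_eq_zero _).2 fun s hs ↦ b.repr.map_eq_zero_iff.1 ?_
    ext i
    refine (injective_iff_map_eq_zero _).1 hC.1 _ (LinearMap.ext fun c ↦ ?_)
    have h := LinearMap.congr_fun hs (1 ⊗ₜ[R] c)
    rw [LinearMap.lsmul_apply, TensorProduct.smul_tmul', smul_eq_mul, mul_one,
      LinearMap.zero_apply] at h
    simpa [h] using (hrepr s c i).symm
  · intro φ
    choose r hr using fun i ↦ hC.2 (Finsupp.lapply i ∘ₗ
      (TensorProduct.equivFinsuppOfBasisLeft b).toLinearMap ∘ₗ φ.restrictScalars R ∘ₗ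
        TensorProduct.mk R S C 1)
    refine ⟨b.equivFun.symm r, TensorProduct.AlgebraTensorModule.curry_injective ?_⟩
    ext c
    apply (TensorProduct.equivFinsuppOfBasisLeft b).injective
    ext i
    have h := LinearMap.congr_fun (hr i) c
    simp only [LinearMap.lsmul_apply, LinearMap.comp_apply, LinearMap.restrictScalars_apply,
      TensorProduct.mk_apply, Finsupp.lapply_apply, LinearEquiv.coe_coe] at h
    simp only [TensorProduct.AlgebraTensorModule.curry_apply,
      TensorProduct.curry_apply, LinearMap.lsmul_apply, TensorProduct.smul_tmul', smul_eq_mul,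
      mul_one, LinearMap.coe_restrictScalars]
    rw [hrepr, ← h, ← b.equivFun_apply, LinearEquiv.apply_symm_apply]

/-- A free module `S` of finite rank gives `S ⊗ C` the structure of a finite power of `C`. -/
noncomputable def baseChangeEquivPi (R S : Type*) [CommRing R] [CommRing S] [Algebra R S]
    [Module.Free R S] [Module.Finite R S] [Nontrivial R] (C : Type*) [AddCommGroup C]
    [Module R C] : TensorProduct R S C ≃ₗ[R] (Fin (Module.finrank R S) → C) :=
  (TensorProduct.equivFinsuppOfBasisLeft (Module.finBasis R S)).trans
    (Finsupp.linearEquivFunOnFinite R C _)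

end Algebra

/-! ### Semidualizing and canonical modules under base change -/

section Canonical

open Abelian

theorem IsLocalRing.isSimpleModule_residueField (R : Type*) [CommRing R] [IsLocalRing R] :
    IsSimpleModule R (IsLocalRing.ResidueField R) :=
  isSimpleModule_iff_quot_maximal.2
    ⟨IsLocalRing.maximalIdeal R, inferInstance, ⟨LinearEquiv.refl R _⟩⟩

/-- The long exact sequence is applied along a composition series, all of whose factors are
isomorphic to the residue field. -/
theorem IsCanonicalModule.ext_of_isFiniteLength {S : Type u} [CommRing S] [IsLocalRing S]
    {K : Type u} [AddCommGroup K] [Module S K] (hK : IsCanonicalModule S K) {M : Type u}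
    [AddCommGroup M] [Module S M] (hM : IsFiniteLength S M) :
    (∀ i : ℕ, (i : WithBot ℕ∞) ≠ ringKrullDim S →
      Subsingleton (Ext (ModuleCat.of S M) (ModuleCat.of S K) i)) ∧
    ∀ d : ℕ, (d : WithBot ℕ∞) = ringKrullDim S →
      Module.length S (Ext (ModuleCat.of S M) (ModuleCat.of S K) d) = Module.length S M := by
  induction hM with
  | @of_subsingleton M _ _ _ =>
    have h (i : ℕ) : Subsingleton (Ext (ModuleCat.of S M) (ModuleCat.of S K) i) := by
      refine subsingleton_of_forall_eq 0 fun x ↦ ?_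
      have h0 : 𝟙 (ModuleCat.of S M) = 0 := by
        ext m
        exact Subsingleton.elim (α := M) _ _
      rw [← Ext.mk₀_id_comp x, h0, Ext.mk₀_zero, Ext.zero_comp]
    exact ⟨fun i _ ↦ h i, fun d _ ↦ by
      have := h d
      rw [Module.length_eq_zero, Module.length_eq_zero]⟩
  | @of_simple_quotient M _ _ N _ _ ih =>
    obtain ⟨I, hI, ⟨e⟩⟩ := isSimpleModule_iff_quot_maximal.1 ‹IsSimpleModule S (M ⧸ N)›
    obtain rfl := IsLocalRing.eq_maximalIdeal hI
    have e' (i : ℕ) : Ext (ModuleCat.of S (M ⧸ N)) (ModuleCat.of S K) i ≃ₗ[S]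
        Ext (ModuleCat.of S (IsLocalRing.ResidueField S)) (ModuleCat.of S K) i :=
      extCongr e.toModuleIso (Iso.refl _) i
    have hQ (i : ℕ) (hi : (i : WithBot ℕ∞) ≠ ringKrullDim S) :
        Subsingleton (Ext (ModuleCat.of S (M ⧸ N)) (ModuleCat.of S K) i) :=
      have := hK.ext_eq_zero i hi
      (e' i).subsingleton
    let T : ShortComplex (ModuleCat.{u} S) :=
      ShortComplex.mk (ModuleCat.ofHom N.subtype) (ModuleCat.ofHom N.mkQ)
        (by ext x; simp)
    have hT : T.ShortExact :=
      { exact := (ShortComplex.ShortExact.moduleCat_exact_iff_function_exact _).2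
          (LinearMap.exact_subtype_mkQ N)
        mono_f := (ModuleCat.mono_iff_injective _).2 N.injective_subtype
        epi_g := (ModuleCat.epi_iff_surjective _).2 N.mkQ_surjective }
    refine ⟨fun i hi ↦ subsingleton_of_forall_eq 0 fun x ↦ ?_, fun d hd ↦ ?_⟩
    · obtain ⟨y, rfl⟩ := Ext.contravariant_sequence_exact₂ hT _ x
        ((ih.1 i hi).elim _ _)
      rw [(hQ i hi).elim y 0, Ext.comp_zero]
    · have hne (j : ℕ) (hj : j ≠ d) : (j : WithBot ℕ∞) ≠ ringKrullDim S := by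
        rw [← hd]
        exact_mod_cast hj
      rw [Module.length_eq_add_of_exact (R := S) N.subtype N.mkQ N.injective_subtype
        N.mkQ_surjective (LinearMap.exact_subtype_mkQ N), ← ih.2 d hd,
        Module.length_eq_one S (M ⧸ N), add_comm,
        Module.length_eq_add_of_exact (R := S)
          (Ext.precompOfLinear (Ext.mk₀ T.g) S (ModuleCat.of S K) (zero_add d))
          (Ext.precompOfLinear (Ext.mk₀ T.f) S (ModuleCat.of S K) (zero_add d)) ?_ ?_ ?_]
      · congr 1
        have := IsLocalRing.isSimpleModule_residueField S
        rw [← Module.length_eq_one S (IsLocalRing.ResidueField S)]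
        exact ((e' d).trans (hK.ext_dim d hd).some).length_eq
      · refine (injective_iff_map_eq_zero _).2 fun x hx ↦ ?_
        cases d with
        | zero =>
          obtain ⟨y, rfl⟩ := (Ext.mk₀_bijective _ _).2 x
          have := hT.epi_g
          rw [Ext.mk₀_eq_zero_iff]
          simpa [← cancel_epi T.g] using hx
        | succ d =>
          obtain ⟨y, rfl⟩ := Ext.contravariant_sequence_exact₃ hT _ x hx (add_comm 1 d)
          rw [(ih.1 d (hne d (by simp))).elim y 0, Ext.comp_zero]
      · exact fun x ↦ Ext.contravariant_sequence_exact₁ hT _ x (add_comm 1 d)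
          ((hQ (d + 1) (hne _ (by simp))).elim _ _)
      · exact (ShortComplex.ab_exact_iff_function_exact _).1
          (Ext.contravariant_sequence_exact₂' hT (ModuleCat.of S K) d)

variable {R S : Type u} [CommRing R] [CommRing S] [Algebra R S] [Module.Free R S]
    [Module.Finite R S] {C : Type u} [AddCommGroup C] [Module R C]

theorem IsSemidualizing.baseChange [Nontrivial R] (hC : IsSemidualizing R C) :
    IsSemidualizing S (TensorProduct R S C) where
  finite := have := hC.finite; inferInstance
  homothety_bijective := lsmul_baseChange_bijective hC.homothety_bijective
  ext_eq_zero i hi := by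
    have := hC.ext_eq_zero i hi
    obtain ⟨e, -⟩ := exists_ext_baseChange_equiv R S C (TensorProduct R S C) i
    exact (e.symm.toEquiv.trans
      ((extCongr (Iso.refl _) (baseChangeEquivPi R S C).toModuleIso i).trans
        (extPi (ModuleCat.of R C) C i)).toEquiv).subsingleton

/-- The modules `Ext_S^d(S ⊗ κ, K)` and `S ⊗ κ` have the same length over `S`, hence over `R`; as
`R`-modules they are the `n`-th powers of `Ext_R^d(κ, C)` and of the residue field `κ` of `R`. -/
theorem IsCanonicalModule.of_baseChange_equiv [IsLocalRing R] [IsLocalRing S]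
    [Module.Finite R C] {K : Type u} [AddCommGroup K] [Module S K] (hK : IsCanonicalModule S K)
    (f : TensorProduct R S C ≃ₗ[S] K) : IsCanonicalModule R C := by
  let κ := IsLocalRing.ResidueField R
  let n := Module.finrank R S
  have hn : 0 < n := (Module.finrank_pos_iff_of_free R S).2 inferInstance
  have hdim : ringKrullDim S = ringKrullDim R := ringKrullDim_eq_of_isIntegral
  have : IsSimpleModule R κ := IsLocalRing.isSimpleModule_residueField R
  have hfin : IsFiniteLength S (TensorProduct R S κ) := by
    have h : IsFiniteLength R (TensorProduct R S κ) :=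
      (baseChangeEquivPi R S κ).symm.isFiniteLength
        (isFiniteLength_iff_isNoetherian_isArtinian.2 ⟨inferInstance, inferInstance⟩)
    rw [isFiniteLength_iff_isNoetherian_isArtinian] at h ⊢
    have := h.1
    have := h.2
    exact ⟨isNoetherian_of_tower R inferInstance, isArtinian_of_tower R inferInstance⟩
  obtain ⟨h0, hd⟩ := hK.ext_of_isFiniteLength hfin
  let E (i : ℕ) := Ext (ModuleCat.of S (TensorProduct R S κ)) (ModuleCat.of S K) i
  let (i : ℕ) : Module R (E i) := Module.compHom _ (algebraMap R S)
  have (i : ℕ) : IsScalarTower R S (E i) := ⟨fun r s x ↦ by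
    rw [Algebra.smul_def, mul_smul]; rfl⟩
  have e (i : ℕ) : Nonempty (E i ≃ₗ[R] (Fin n → Ext (ModuleCat.of R κ) (ModuleCat.of R C) i)) := by
    obtain ⟨e, he⟩ := exists_ext_baseChange_equiv R S κ (TensorProduct R S C) i
    let e' : Ext (ModuleCat.of R κ) (ModuleCat.of R (TensorProduct R S C)) i ≃ₗ[R] E i :=
      (e.trans (extCongr (Iso.refl _) f.toModuleIso i).toAddEquiv).toLinearEquiv fun r x ↦ by
        change extCongr (Iso.refl _) f.toModuleIso i (e (r • x)) =
          algebraMap R S r • extCongr (Iso.refl _) f.toModuleIso i (e x)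
        rw [he, map_smul]
    exact ⟨e'.symm.trans ((extCongr (Iso.refl _) (baseChangeEquivPi R S C).toModuleIso i).trans
      (extPi (ModuleCat.of R κ) C i))⟩
  refine ⟨inferInstance, fun d hdR ↦ ?_, fun i hi ↦ ?_⟩
  · have hdS := hd d (hdR.trans hdim.symm)
    have hfinE : IsFiniteLength S (E d) := by
      rw [← Module.length_ne_top_iff] at hfin ⊢
      exact hdS.trans_ne hfin
    have h : Module.length R (E d) = Module.length R (TensorProduct R S κ) := by
      rw [hfinE.length_restrictScalars R, hfin.length_restrictScalars R]
      exact congrArg (· * _) hdS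
    rw [(e d).some.length_eq, (baseChangeEquivPi R S κ).length_eq, Module.length_pi_of_fintype,
      Module.length_pi_of_fintype, Module.length_eq_one R κ] at h
    have h1 : Module.length R (Ext (ModuleCat.of R κ) (ModuleCat.of R C) d) = 1 := by
      simp only [Finset.sum_const, Finset.card_univ, Fintype.card_fin, nsmul_eq_mul] at h
      exact (ENat.mul_right_strictMono (by exact_mod_cast hn.ne')
        (ENat.natCast_ne_top n)).injective h
    obtain ⟨I, hI, e'⟩ := isSimpleModule_iff_quot_maximal.1 (Module.length_eq_one_iff.1 h1)
    obtain rfl := IsLocalRing.eq_maximalIdeal hI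
    exact e'
  · have := h0 i (hdim ▸ hi)
    have := (e i).some.symm.subsingleton
    refine subsingleton_of_forall_eq 0 fun x ↦ ?_
    exact congrFun (Subsingleton.elim (fun _ : Fin n ↦ x) 0) ⟨0, hn⟩

theorem HasNontrivialSemidualizingModule.of_free_of_finite [IsLocalRing R] [IsLocalRing S]
    (h : HasNontrivialSemidualizingModule R) : HasNontrivialSemidualizingModule S := by
  obtain ⟨C, _, _, hC, hR, hK⟩ := h
  have := hC.finite
  refine ⟨TensorProduct R S C, inferInstance, inferInstance, hC.baseChange, fun ⟨e⟩ ↦ hR ?_,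
    fun K _ _ hcan ⟨e⟩ ↦ hK C (hcan.of_baseChange_equiv e) ⟨.refl R C⟩⟩
  have : Nonempty (Fin (Module.finrank R S)) := Fin.pos_iff_nonempty.1
    ((Module.finrank_pos_iff_of_free R S).2 inferInstance)
  exact nonempty_linearEquiv_of_pi ((baseChangeEquivPi R S C).symm.trans
    ((e.restrictScalars R).trans (Module.finBasis R S).equivFun))

end Canonical

/-! ### Gluings of semigroups -/

section Gluing

theorem mem_gluedSemigroup_iff {H : AddSubmonoid ℕ} {a b : ℕ} (ha : a ∈ H) (hb : 0 < b) {n : ℕ} :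
    n ∈ gluedSemigroup H a b ↔ ∃ i < b, ∃ h ∈ H, n = a * i + b * h := by
  constructor
  · intro hn
    induction hn using AddSubmonoid.closure_induction with
    | mem x hx =>
      rcases hx with rfl | ⟨h, hh, rfl⟩
      · obtain rfl | hb1 := eq_or_ne b 1
        · exact ⟨0, hb, x, ha, by simp⟩
        · exact ⟨1, by omega, 0, H.zero_mem, by simp⟩
      · exact ⟨0, hb, h, hh, by simp⟩
    | zero => exact ⟨0, hb, 0, H.zero_mem, by simp⟩
    | add x y _ _ hx hy =>
      obtain ⟨i, hi, h, hh, rfl⟩ := hx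
      obtain ⟨j, hj, g, hg, rfl⟩ := hy
      -- Since `a ∈ H`, a carry of `b` in the multiple of `a` is absorbed into `b * H`.
      refine ⟨(i + j) % b, Nat.mod_lt _ hb, h + g + (i + j) / b * a,
        H.add_mem (H.add_mem hh hg) (by simpa using H.nsmul_mem ha ((i + j) / b)), ?_⟩
      nlinarith [Nat.mod_add_div (i + j) b]
  · rintro ⟨i, -, h, hh, rfl⟩
    refine add_mem ?_ (AddSubmonoid.subset_closure (Or.inr ⟨h, hh, rfl⟩))
    have h := nsmul_mem (AddSubmonoid.subset_closure (Set.mem_insert a _) :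
      a ∈ gluedSemigroup H a b) i
    rwa [smul_eq_mul, mul_comm] at h

theorem gluedSemigroup_zero_right {H : AddSubmonoid ℕ} (h1 : 1 ∈ H) :
    gluedSemigroup H 1 0 = H := by
  have hall (K : AddSubmonoid ℕ) (hK : 1 ∈ K) : K = ⊤ :=
    top_unique fun n _ ↦ by simpa using K.nsmul_mem hK n
  rw [hall H h1]
  exact hall _ (AddSubmonoid.subset_closure (Set.mem_insert 1 _))

/-- The ring homomorphism `k⟦H⟧ → k⟦⟨a, bH⟩⟧`, `f(t) ↦ f(t ^ b)`. -/
noncomputable def gluingHom (k : Type u) [Field k] (H : AddSubmonoid ℕ) (a : ℕ) {b : ℕ}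
    (hb : b ≠ 0) : semigroupRing k H →+* semigroupRing k (gluedSemigroup H a b) :=
  (PowerSeries.expand b hb (R := k)).toRingHom.restrict _ _ fun f hf n hn ↦ by
    by_cases hd : b ∣ n
    · obtain ⟨m, rfl⟩ := hd
      exact AddSubmonoid.subset_closure (Or.inr ⟨m, hf m (by simpa using hn), rfl⟩)
    · exact absurd (PowerSeries.coeff_expand_of_not_dvd b hb f hd) hn

theorem coeff_X_pow_mul_expand {k : Type*} [CommRing k] {a b : ℕ} (hb : b ≠ 0)
    (hab : Nat.gcd a b = 1) (f : PowerSeries k) {i j : ℕ} (hi : i < b) (hj : j < b) (m : ℕ) :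
    PowerSeries.coeff (a * j + b * m) (PowerSeries.X ^ (a * i) * PowerSeries.expand b hb f) =
      if i = j then PowerSeries.coeff m f else 0 := by
  rw [PowerSeries.coeff_X_pow_mul']
  split_ifs with h1 h2 h2
  · subst h2
    rw [Nat.add_sub_cancel_left, PowerSeries.coeff_expand_mul]
  · refine PowerSeries.coeff_expand_of_not_dvd b hb f fun hd ↦ h2 ?_
    have h : a * i ≡ a * j [MOD b] :=
      ((Nat.modEq_iff_dvd' h1).2 hd).trans (by simp [Nat.ModEq])
    exact (Nat.ModEq.cancel_left_of_coprime (by rwa [Nat.gcd_comm]) h).eq_of_lt_of_lt hi hj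
  · subst h2
    omega
  · rfl

/-- The powers `t ^ (a * i)` with `i < b` are a basis of `k⟦⟨a, bH⟩⟧` over `k⟦H⟧`: each exponent is
`a * i + b * h` with `h ∈ H` for exactly one such `i`, since `a` is prime to `b`. -/
theorem nonempty_gluing_linearEquiv (k : Type u) [Field k] {H : AddSubmonoid ℕ} {a b : ℕ}
    (ha : a ∈ H) (hb : b ≠ 0) (hab : Nat.gcd a b = 1) :
    letI := (gluingHom k H a hb).toAlgebra
    Nonempty ((Fin b → semigroupRing k H) ≃ₗ[semigroupRing k H]
      semigroupRing k (gluedSemigroup H a b)) := by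
  let := (gluingHom k H a hb).toAlgebra
  have hmem {n : ℕ} := mem_gluedSemigroup_iff (n := n) ha (Nat.pos_of_ne_zero hb)
  let v (i : Fin b) : semigroupRing k (gluedSemigroup H a b) :=
    ⟨PowerSeries.X ^ (a * (i : ℕ)), fun n hn ↦ by
      rw [PowerSeries.coeff_X_pow] at hn
      exact hmem.2 ⟨i, i.2, 0, H.zero_mem, by simpa using (ite_ne_right_iff.1 hn).1⟩⟩
  let L := Fintype.linearCombination (semigroupRing k H) v
  have hL (f : Fin b → semigroupRing k H) (j : Fin b) (m : ℕ) :
      PowerSeries.coeff (a * j + b * m) (L f : PowerSeries k) =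
        PowerSeries.coeff m (f j : PowerSeries k) := by
    have h : (L f : PowerSeries k) = ∑ i : Fin b,
        PowerSeries.X ^ (a * (i : ℕ)) * PowerSeries.expand b hb (f i : PowerSeries k) := by
      simp only [L, Fintype.linearCombination_apply, AddSubmonoidClass.coe_finsetSum]
      exact Finset.sum_congr rfl fun i _ ↦ mul_comm _ _
    rw [h, map_sum, Finset.sum_eq_single j]
    · rw [coeff_X_pow_mul_expand hb hab _ j.2 j.2, if_pos rfl]
    · intro i _ hij
      rw [coeff_X_pow_mul_expand hb hab _ i.2 j.2, if_neg (Fin.val_ne_of_ne hij)]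
    · simp
  refine ⟨LinearEquiv.ofBijective L ⟨fun f g hfg ↦ ?_, fun g ↦ ?_⟩⟩
  · ext j m
    rw [← hL, ← hL, hfg]
  · classical
    refine ⟨fun i ↦ ⟨PowerSeries.mk fun h ↦ if h ∈ H then
      PowerSeries.coeff (a * i + b * h) (g : PowerSeries k) else 0, fun n hn ↦ ?_⟩, ?_⟩
    · rw [PowerSeries.coeff_mk] at hn
      exact (ite_ne_right_iff.1 hn).1
    · ext n
      by_cases hn : n ∈ gluedSemigroup H a b
      · obtain ⟨i, hi, h, hh, rfl⟩ := hmem.1 hn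
        rw [hL _ ⟨i, hi⟩, PowerSeries.coeff_mk, if_pos hh]
      · rw [not_imp_comm.1 (Subtype.prop (L _) n) hn, not_imp_comm.1 (g.2 n) hn]

end Gluing

theorem corollary5p4 (k : Type u) [Field k] (H : AddSubmonoid ℕ) (hH : IsNumericalSemigroup H)
    (a b : ℕ) (ha : a ∈ H) (hab : Nat.gcd a b = 1)
    (h : HasNontrivialSemidualizingModule (semigroupRing k H)) :
    HasNontrivialSemidualizingModule (semigroupRing k (gluedSemigroup H a b)) := by
  obtain rfl | hb := eq_or_ne b 0
  · rw [Nat.gcd_zero_right] at hab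
    subst hab
    rwa [gluedSemigroup_zero_right ha]
  · let := (gluingHom k H a hb).toAlgebra
    obtain ⟨e⟩ := nonempty_gluing_linearEquiv k ha hb hab
    have := Module.Free.of_equiv e
    have := Module.Finite.equiv e
    exact h.of_free_of_finite
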